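/- Let $\mathbb{K}=\mathbb{R}$ or $\mathbb{C}$. For a normed space $(X,\|\cdot\|)$ and a locally convex Hausdorff topology $\tau$ on $X$ that is coarser than the norm topology $\tau_{\|\cdot\|}$ (then $(X,\|\cdot\|,\tau)$ is called a pre-Saks space), the mixed topology $\gamma(\|\cdot\|,\tau)$ is the finest linear topology $\gamma$ on $X$ that coincides with $\tau$ on $\|\cdot\|$-bounded sets and satisfies $\tau\leq\gamma\leq\tau_{\|\cdot\|}$. The triple $(X,\|\cdot\|,\tau)$ is a Saks space if moreover $\tau$ is generated by a directed system $\Gamma$ of seminorms with $\|x\|=\sup_{q\in\Gamma}q(x)$ for all $x\in X$. A Saks space is called semi-reflexive if $(X,\gamma(\|\cdot\|,\tau))$ is semi-reflexive, and semi-Montel if every bounded subset of $(X,\gamma(\|\cdot\|,\tau))$ is relatively compact. Let $\mathcal{F}$ be a linear space of $\mathbb{K}$-valued functions on a non-empty set $\Omega$ and let $(\mathcal{F},\|\cdot\|,\tau)$ be a semi-reflexive Saks space. Put $\gamma:=\gamma(\|\cdot\|,\tau)$ and $\mathcal{F}_\gamma':=(\mathcal{F},\gamma)'$, equipped with the restriction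 $\|\cdot\|_{\mathcal{F}_\gamma'}$ of the dual norm of $(\mathcal{F},\|\cdot\|)^*$, and suppose that all point evaluations $\delta_x\colon f\mapsto f(x)$, $x\in\Omega$, belong to $\mathcal{F}_\gamma'$ (this holds, for example, if $\tau$ is finer than the topology $\tau_{\mathrm p}$ of pointwise convergence). Let $\sigma_{\mathcal I}(\mathcal{F},\mathcal{F}_\gamma')$ be the locally convex topology generated by the seminorms $f\mapsto\sup_{f'\in N}|f'(f)|$ for finite $N\subset\mathcal{F}_\gamma'$, let $b\sigma_{\mathcal I}(\mathcal{F},\mathcal{F}_\gamma')$ (the bounded weak$^*$ topology) be the finest locally convex Hausdorff topology on $\mathcal{F}$ that coincides with $\sigma_{\mathcal I}(\mathcal{F},\mathcal{F}_\gamma')$ on $\|\cdot\|$-bounded sets, and let $\tau_{\mathrm c,\mathcal I}(\mathcal{F},\mathcal{F}_\gamma')$ be the topology generated by the seminorms $f\mapsto\sup_{f'\in K}|f'(f)|$ for $\|\cdot\|_{\mathcal{F}_\gamma'}$-compact $K\subset\mathcal{F}_\gamma'$. Then $(\mathcal{F},\|\cdot\|,\tau_{\mathrm p})$ and $(\mathcal{F},\|\cdot\|,\sigma_{\mathcal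 I}(\mathcal{F},\mathcal{F}_\gamma'))$ are pre-Saks spaces, and \[ \gamma(\|\cdot\|,\tau_{\mathrm p})=\gamma(\|\cdot\|,\sigma_{\mathcal I}(\mathcal{F},\mathcal{F}_\gamma'))=b\sigma_{\mathcal I}(\mathcal{F},\mathcal{F}_\gamma')=\tau_{\mathrm c,\mathcal I}(\mathcal{F},\mathcal{F}_\gamma'). \] If $(\mathcal{F},\|\cdot\|,\tau)$ is even semi-Montel, then $\gamma=\gamma(\|\cdot\|,\tau_{\mathrm p})$. -/

import Mathlib

open Topology Bornology

/-! In this file a second topology on a normed space is always passed explicitly. Everything that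
refers to the norm (dual space, bounded sets, norm topology) is fixed before such a topology enters
the context, and uses the norm of `X` only. -/

section NormData

/-- The norm dual `X*` of a normed space, with the dual norm. -/
abbrev NormDual (𝕜 X : Type*) [RCLike 𝕜] [NormedAddCommGroup X] [NormedSpace 𝕜 X] : Type _ :=
  StrongDual 𝕜 X

/-- The topology induced by the norm. -/
abbrev normTopology (X : Type*) [NormedAddCommGroup X] : TopologicalSpace X :=
  inferInstance

variable {𝕜 X : Type*} [RCLike 𝕜] [NormedAddCommGroup X] [NormedSpace 𝕜 X]

theorem bddAbove_range_norm_apply {V : Submodule 𝕜 (NormDual 𝕜 X)} {K : Set V}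
    (hK : ∃ C, ∀ f ∈ K, ‖(f : NormDual 𝕜 X)‖ ≤ C) (x : X) :
    BddAbove (Set.range fun f : K => ‖(f.1 : NormDual 𝕜 X) x‖) := by
  obtain ⟨C, hC⟩ := hK
  refine ⟨C * ‖x‖, ?_⟩
  rintro _ ⟨f, rfl⟩
  exact ((f.1 : NormDual 𝕜 X).le_opNorm x).trans
    (mul_le_mul_of_nonneg_right (hC f.1 f.2) (norm_nonneg x))

/-- The seminorm `x ↦ sup_{f ∈ K} |f x|` on `X`, for a norm-bounded set `K` of functionals. -/
noncomputable def supSeminorm {V : Submodule 𝕜 (NormDual 𝕜 X)} (K : Set V)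
    (hK : ∃ C, ∀ f ∈ K, ‖(f : NormDual 𝕜 X)‖ ≤ C) : Seminorm 𝕜 X :=
  Seminorm.of (fun x => ⨆ f : K, ‖(f.1 : NormDual 𝕜 X) x‖)
    (fun x y => by
      have h0 : ∀ z : X, 0 ≤ ⨆ f : K, ‖(f.1 : NormDual 𝕜 X) z‖ :=
        fun z => Real.iSup_nonneg fun f => norm_nonneg _
      refine Real.iSup_le (fun f => ?_) (add_nonneg (h0 x) (h0 y))
      rw [map_add]
      exact (norm_add_le _ _).trans (add_le_add
        (le_ciSup (bddAbove_range_norm_apply hK x) f)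
        (le_ciSup (bddAbove_range_norm_apply hK y) f)))
    (fun a x => by
      simp only [map_smul, norm_smul]
      exact (Real.mul_iSup_of_nonneg (norm_nonneg a) _).symm)

/-- The seminorms `x ↦ sup_{f ∈ N} |f x|` for finite sets `N ⊆ V`. -/
noncomputable def finiteSeminorms (V : Submodule 𝕜 (NormDual 𝕜 X)) :
    SeminormFamily 𝕜 X {N : Set V // N.Finite} :=
  fun N => supSeminorm N.1 (N.2.isCompact.exists_bound_of_continuousOn continuous_subtype_val.continuousOn)

/-- The seminorms `x ↦ sup_{f ∈ K} |f x|` for norm-compact sets `K ⊆ V`. -/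
noncomputable def compactSeminorms (V : Submodule 𝕜 (NormDual 𝕜 X)) :
    SeminormFamily 𝕜 X {K : Set V // IsCompact K} :=
  fun K => supSeminorm K.1 (K.2.exists_bound_of_continuousOn continuous_subtype_val.continuousOn)

/-- The weak topology `σ(X, V)`: it is generated by the seminorms `x ↦ sup_{f ∈ N} |f x|` for
finite sets `N ⊆ V`. -/
@[reducible] noncomputable def weakTopologyOf (V : Submodule 𝕜 (NormDual 𝕜 X)) :
    TopologicalSpace X :=
  (finiteSeminorms V).moduleFilterBasis.topology

/-- The topology of uniform convergence on the norm-compact subsets of `V`: it is generated by the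
seminorms `x ↦ sup_{f ∈ K} |f x|` for norm-compact sets `K ⊆ V`. -/
@[reducible] noncomputable def compactTopologyOf (V : Submodule 𝕜 (NormDual 𝕜 X)) :
    TopologicalSpace X :=
  (compactSeminorms V).moduleFilterBasis.topology

end NormData

section Topologies

/-- `t` is a vector space topology. -/
def IsVectorTopology (𝕜 : Type*) {X : Type*} [RCLike 𝕜] [AddCommGroup X] [Module 𝕜 X]
    (t : TopologicalSpace X) : Prop :=
  @IsTopologicalAddGroup X t _ ∧ @ContinuousSMul 𝕜 X _ _ t

/-- `t` is a locally convex Hausdorff topology, that is, it is Hausdorff and generated by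
seminorms. -/
def IsLCHTopology (𝕜 : Type*) {X : Type*} [RCLike 𝕜] [AddCommGroup X] [Module 𝕜 X]
    (t : TopologicalSpace X) : Prop :=
  PolynormableSpace 𝕜 X (topology := t) ∧ @T2Space X t

/-- A topological vector space is semi-reflexive if every continuous linear functional on its strong
dual (the dual with the topology of uniform convergence on bounded sets) is the evaluation at a
point. -/
def IsSemireflexive (𝕜 X : Type*) [RCLike 𝕜] [AddCommGroup X] [Module 𝕜 X]
    [TopologicalSpace X] : Prop :=
  ∀ φ : StrongDual 𝕜 (StrongDual 𝕜 X), ∃ x : X, ∀ f : StrongDual 𝕜 X, φ f = f x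

/-- The topologies `t` and `s` induce the same topology on each norm-bounded set. -/
def CoincideOnBounded {X : Type*} [NormedAddCommGroup X] (t s : TopologicalSpace X) : Prop :=
  ∀ B : Set X, IsBounded B →
    TopologicalSpace.induced ((↑) : B → X) t = TopologicalSpace.induced ((↑) : B → X) s

variable (𝕜 : Type*) {X : Type*} [RCLike 𝕜] [NormedAddCommGroup X] [NormedSpace 𝕜 X]

/-- `(X, ‖·‖, τ)` is a pre-Saks space: `τ` is a locally convex Hausdorff topology that is coarser
than the norm topology. (In Mathlib `t ≤ s` means that `t` is finer than `s`.) -/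
def IsPreSaks (τ : TopologicalSpace X) : Prop :=
  IsLCHTopology 𝕜 τ ∧ normTopology X ≤ τ

/-- `(X, ‖·‖, τ)` is a Saks space: a pre-Saks space such that `τ` is generated by a directed system
`Γ` of seminorms with `‖x‖ = sup_{q ∈ Γ} q x` for all `x`. -/
def IsSaks (τ : TopologicalSpace X) : Prop :=
  IsPreSaks 𝕜 τ ∧ ∃ Γ : Set (Seminorm 𝕜 X), DirectedOn (· ≤ ·) Γ ∧
    WithSeminorms (fun q : Γ => q.1) (topology := τ) ∧
    ∀ x : X, IsLUB ((fun q : Seminorm 𝕜 X => q x) '' Γ) ‖x‖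

/-- The linear topologies between `τ` and the norm topology that coincide with `τ` on the
norm-bounded sets. -/
def mixedCandidates (τ : TopologicalSpace X) : Set (TopologicalSpace X) :=
  {t | IsVectorTopology 𝕜 t ∧ CoincideOnBounded t τ ∧ t ≤ τ ∧ normTopology X ≤ t}

/-- The mixed topology `γ(‖·‖, τ)`: the finest of these topologies. -/
@[reducible] def mixedTopology (τ : TopologicalSpace X) : TopologicalSpace X :=
  sInf (mixedCandidates 𝕜 τ)

/-- The space `X_γ'` of functionals that are continuous for `γ = γ(‖·‖, τ)`, as a subspace of the
norm dual (`γ` is coarser than the norm topology), with the restriction of the dual norm. -/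
def mixedDual (τ : TopologicalSpace X) : Submodule 𝕜 (NormDual 𝕜 X) where
  carrier := {f | Continuous[mixedTopology 𝕜 τ, inferInstance] f}
  add_mem' := fun {f g} hf hg => by
    let := mixedTopology 𝕜 τ
    exact Continuous.add (f := f) (g := g) hf hg
  zero_mem' := by
    let := mixedTopology 𝕜 τ
    exact continuous_const (y := (0 : 𝕜))
  smul_mem' := fun c f hf => by
    let := mixedTopology 𝕜 τ
    exact Continuous.const_smul (g := f) hf c

/-- A Saks space is semi-reflexive if `(X, γ)` is semi-reflexive. -/
def IsSemireflexiveSaks (τ : TopologicalSpace X) : Prop :=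
  IsSaks 𝕜 τ ∧ @IsSemireflexive 𝕜 X _ _ _ (mixedTopology 𝕜 τ)

/-- A Saks space is semi-Montel if `(X, γ)` is semi-Montel, that is, its bounded sets are relatively
compact. (Mathlib's `MontelSpace` does not require the space to be barrelled.) -/
def IsSemiMontelSaks (τ : TopologicalSpace X) : Prop :=
  IsSaks 𝕜 τ ∧ @MontelSpace 𝕜 X _ _ _ (mixedTopology 𝕜 τ)

variable {𝕜}

/-- The locally convex Hausdorff topologies that coincide with `σ(X, V)` on the norm-bounded
sets. -/
def boundedWeakStarCandidates (V : Submodule 𝕜 (NormDual 𝕜 X)) : Set (TopologicalSpace X) :=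
  {t | IsLCHTopology 𝕜 t ∧ CoincideOnBounded t (weakTopologyOf V)}

/-- The bounded weak* topology: the finest locally convex Hausdorff topology that coincides with
`σ(X, V)` on the norm-bounded sets. -/
@[reducible] def boundedWeakStarTopology (V : Submodule 𝕜 (NormDual 𝕜 X)) : TopologicalSpace X :=
  sInf (boundedWeakStarCandidates V)

/-- The topology of pointwise convergence on a space of functions, given by its linear embedding
into `Ω → 𝕜`. -/
@[reducible] def pointwiseTopology {Ω : Type*} (ev : X →ₗ[𝕜] (Ω → 𝕜)) : TopologicalSpace X :=
  TopologicalSpace.induced ev Pi.topologicalSpace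

theorem coincideOnBounded_sInf {S : Set (TopologicalSpace X)} (hS : S.Nonempty)
    {s : TopologicalSpace X} (h : ∀ t ∈ S, CoincideOnBounded t s) :
    CoincideOnBounded (sInf S) s := by
  intro B hB
  rw [induced_sInf]
  obtain ⟨t₀, ht₀⟩ := hS
  refine le_antisymm (sInf_le ⟨t₀, ht₀, h t₀ ht₀ B hB⟩) (le_sInf ?_)
  rintro _ ⟨t, ht, rfl⟩
  exact (h t ht B hB).ge

/-- For a pre-Saks space the mixed topology is indeed the finest of the topologies in its
definition. -/
theorem isLeast_mixedTopology {τ : TopologicalSpace X} (hτ : IsPreSaks 𝕜 τ) :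
    IsLeast (mixedCandidates 𝕜 τ) (mixedTopology 𝕜 τ) := by
  have hmem : τ ∈ mixedCandidates 𝕜 τ :=
    ⟨⟨hτ.1.1.withSeminorms'.topologicalAddGroup, hτ.1.1.withSeminorms'.continuousSMul⟩,
      fun _ _ => rfl, le_rfl, hτ.2⟩
  exact ⟨⟨⟨topologicalAddGroup_sInf fun t ht => ht.1.1, continuousSMul_sInf fun t ht => ht.1.2⟩,
    coincideOnBounded_sInf ⟨τ, hmem⟩ fun t ht => ht.2.1, sInf_le hmem,
    le_sInf fun t ht => ht.2.2.2⟩, fun t ht => sInf_le ht⟩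

theorem polynormableSpace_of_eq {𝕜 E ι : Type*} [RCLike 𝕜] [AddCommGroup E] [Module 𝕜 E]
    (p : SeminormFamily 𝕜 E ι) {t : TopologicalSpace E} (h : t = p.moduleFilterBasis.topology) :
    PolynormableSpace 𝕜 E :=
  WithSeminorms.toPolynormableSpace ⟨h⟩

/-- If `σ(X, V)` is Hausdorff, then the bounded weak* topology is indeed the finest of the
topologies in its definition. -/
theorem isLeast_boundedWeakStarTopology {V : Submodule 𝕜 (NormDual 𝕜 X)}
    (hV : @T2Space X (weakTopologyOf V)) :
    IsLeast (boundedWeakStarCandidates V) (boundedWeakStarTopology V) := by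
  have hmem : weakTopologyOf V ∈ boundedWeakStarCandidates V :=
    ⟨⟨polynormableSpace_of_eq (finiteSeminorms V) rfl, hV⟩,
      fun _ _ => rfl⟩
  exact ⟨⟨⟨PolynormableSpace.sInf fun t ht => ht.1.1, t2Space_antitone (sInf_le hmem) hV⟩,
    coincideOnBounded_sInf ⟨_, hmem⟩ fun t ht => ht.2⟩, fun t ht => sInf_le ht⟩

end Topologies

/-! ### Seminorm topologies and continuity -/

section Prelim

/-! Write `V` for the mixed dual and `σ` for `σ(F, V)`. Everything rests on the `σ`-compactness of
the closed norm balls. Norm balls are `γ`-bounded, so by semi-reflexivity each linear functional on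
`V` bounded for the dual norm is evaluation at a point; as `V` is norming (Hahn–Banach for the
seminorms of the Saks space), the ball of radius `R` is the set of all linear `ψ` with `|ψ f| ≤
R‖f‖`, compact as in Alaoglu's theorem (`IsSemireflexiveSaks.isCompact_closedBall`).

On compact sets `σ` agrees with the coarser Hausdorff topology of pointwise convergence, and a mixed
topology depends only on traces on bounded sets (`mixedTopology_congr`); this is the first equality.
The others close a cycle: `γ(‖·‖, σ)` is finer than the bounded weak* topology, which is finer than
the compact-convergence topology, which is finer than `γ(‖·‖, σ)` by Banach–Dieudonné
(`compactTopologyOf_le_of_coincideOnBounded`). In the semi-Montel case balls are relatively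
`γ`-compact, so the trace argument applies to `γ` itself. -/

theorem le_of_seminorm_isBounded {𝕜 E ι ι' : Type*} [RCLike 𝕜] [AddCommGroup E] [Module 𝕜 E]
    {p : SeminormFamily 𝕜 E ι} {q : SeminormFamily 𝕜 E ι'}
    (h : Seminorm.IsBounded p q LinearMap.id) :
    p.moduleFilterBasis.topology ≤ q.moduleFilterBasis.topology := by
  rw [← continuous_id_iff_le]
  exact WithSeminorms.continuous_of_isBounded (.mk (topology := _) rfl)
    (.mk (topology := _) rfl) LinearMap.id h

theorem induced_eq_of_seminorm_isBounded {𝕜 E F ι : Type*} [RCLike 𝕜] [AddCommGroup E]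
    [Module 𝕜 E] [AddCommGroup F] [Module 𝕜 F] (B : E →ₗ[𝕜] F →ₗ[𝕜] 𝕜) {q : SeminormFamily 𝕜 E ι}
    (h : Seminorm.IsBounded B.toSeminormFamily q LinearMap.id)
    (h' : Seminorm.IsBounded q B.toSeminormFamily LinearMap.id) :
    q.moduleFilterBasis.topology =
      TopologicalSpace.induced (fun x y => B x y) Pi.topologicalSpace :=
  ((LinearMap.weakBilin_withSeminorms B).congr h h').withSeminorms_eq.symm

theorem continuous_of_eventually_seminorm_lt {𝕜 E ι Y : Type*} [RCLike 𝕜] [AddCommGroup E]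
    [Module 𝕜 E] [TopologicalSpace Y] {p : SeminormFamily 𝕜 E ι} (u : Y → E)
    (h : ∀ x i ε, 0 < ε → ∀ᶠ y in 𝓝 x, p i (u y - u x) < ε) :
    Continuous[_, p.moduleFilterBasis.topology] u := by
  let := p.moduleFilterBasis.topology
  have hp : WithSeminorms p := ⟨rfl⟩
  exact continuous_iff_continuousAt.2 fun x => (hp.tendsto_nhds u (u x)).2 (h x)

theorem continuous_comp_induced {A Z Y : Type*} {t : TopologicalSpace Z}
    {s : TopologicalSpace Y} {f : Z → Y} (hf : Continuous[t, s] f) (g : A → Z) :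
    Continuous[TopologicalSpace.induced g t, s] fun y => f (g y) :=
  @Continuous.comp A Z Y (TopologicalSpace.induced g t) t s g f hf continuous_induced_dom

end Prelim

/-! ### Weak and compact-convergence topologies -/

section FunctionalSeminorms

variable {𝕜 X : Type*} [RCLike 𝕜] [NormedAddCommGroup X] [NormedSpace 𝕜 X]
  {V : Submodule 𝕜 (NormDual 𝕜 X)}

theorem supSeminorm_le {K : Set V} {hK : ∃ C, ∀ f ∈ K, ‖(f : NormDual 𝕜 X)‖ ≤ C} {x : X} {r : ℝ}
    (hr : 0 ≤ r) (h : ∀ f ∈ K, ‖(f : NormDual 𝕜 X) x‖ ≤ r) : supSeminorm K hK x ≤ r :=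
  Real.iSup_le (fun f => h f.1 f.2) hr

theorem norm_apply_le_supSeminorm {K : Set V} (hK : ∃ C, ∀ f ∈ K, ‖(f : NormDual 𝕜 X)‖ ≤ C)
    {f : V} (hf : f ∈ K) (x : X) : ‖(f : NormDual 𝕜 X) x‖ ≤ supSeminorm K hK x :=
  le_ciSup (bddAbove_range_norm_apply hK x) (⟨f, hf⟩ : K)

/-- The pairing of `X` with a space `V` of continuous functionals. -/
def evalPairing (V : Submodule 𝕜 (NormDual 𝕜 X)) : X →ₗ[𝕜] V →ₗ[𝕜] 𝕜 :=
  LinearMap.mk₂ 𝕜 (fun x f => (f : NormDual 𝕜 X) x) (by simp) (by simp) (by simp) (by simp)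

/-- Embeds `σ(X, V)` in the product `𝕜^V`, where Tychonoff's theorem is available. -/
theorem weakTopologyOf_eq_induced (V : Submodule 𝕜 (NormDual 𝕜 X)) :
    weakTopologyOf V =
      TopologicalSpace.induced (fun x (f : V) => (f : NormDual 𝕜 X) x) Pi.topologicalSpace := by
  refine induced_eq_of_seminorm_isBounded (𝕜 := 𝕜) (E := X) (F := V) (evalPairing V) (q := finiteSeminorms V)
    (fun N => ⟨N.2.toFinset, 1, fun x => ?_⟩)
    (fun f => ⟨{⟨{f}, Set.finite_singleton f⟩}, 1, fun x => ?_⟩)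
  · rw [one_smul]
    refine supSeminorm_le (K := N.1) (hK := N.2.isCompact.exists_bound_of_continuousOn
      continuous_subtype_val.continuousOn) (apply_nonneg _ _) fun f hf => ?_
    exact Seminorm.le_finset_sup_apply (p := (evalPairing V).toSeminormFamily) (i := f)
      (N.2.mem_toFinset.2 hf)
  · rw [one_smul, Finset.sup_singleton]
    exact norm_apply_le_supSeminorm (K := {f}) _ rfl x

theorem compactTopologyOf_le_weakTopologyOf (V : Submodule 𝕜 (NormDual 𝕜 X)) :
    compactTopologyOf V ≤ weakTopologyOf V := by
  refine le_of_seminorm_isBounded fun N => ⟨{⟨N.1, N.2.isCompact⟩}, 1, fun x => ?_⟩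
  rw [one_smul, Finset.sup_singleton]
  exact le_rfl

theorem normTopology_le_weakTopologyOf (V : Submodule 𝕜 (NormDual 𝕜 X)) :
    normTopology X ≤ weakTopologyOf V := by
  rw [weakTopologyOf_eq_induced, ← continuous_iff_le_induced]
  fun_prop

theorem continuous_apply_weakTopologyOf (f : V) :
    Continuous[weakTopologyOf V, inferInstance] (f : NormDual 𝕜 X) := by
  rw [weakTopologyOf_eq_induced]
  exact continuous_comp_induced (continuous_apply (A := fun _ : V => 𝕜) f)
    (fun x (f : V) => (f : NormDual 𝕜 X) x)

/-- A norm-compact `K` is totally bounded, so on a bounded set the supremum over `K` is controlled,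
up to a small error, by finitely many functionals. -/
theorem coincideOnBounded_compactTopologyOf (V : Submodule 𝕜 (NormDual 𝕜 X)) :
    CoincideOnBounded (compactTopologyOf V) (weakTopologyOf V) := by
  intro B hB
  refine le_antisymm (induced_mono (compactTopologyOf_le_weakTopologyOf V)) ?_
  obtain ⟨R, hR0, hR⟩ := hB.exists_pos_norm_le
  rw [← continuous_iff_le_induced]
  let : TopologicalSpace B := TopologicalSpace.induced (↑) (weakTopologyOf V)
  have hc (f : V) : Continuous fun y : B => (f : NormDual 𝕜 X) y :=
    continuous_comp_induced (continuous_apply_weakTopologyOf f) _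
  refine continuous_of_eventually_seminorm_lt _ fun x K ε hε => ?_
  -- Points of `B` are at most `2 * R` apart, so replacing `f` by a point of the net costs at most
  -- `ε / 4`.
  obtain ⟨N, hN, hKN⟩ := Metric.totallyBounded_iff.1 K.2.totallyBounded (ε / (8 * R))
    (by positivity)
  have hev : ∀ᶠ y : B in 𝓝 x, ∀ f ∈ N,
      ‖(f : NormDual 𝕜 X) y - (f : NormDual 𝕜 X) x‖ < ε / 4 := by
    refine (Filter.eventually_all_finite hN).2 fun f _ => ?_
    have := ((hc f).sub (continuous_const (y := (f : NormDual 𝕜 X) x))).norm.tendsto x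
    exact this.eventually_lt_const (by simpa using hε)
  filter_upwards [hev] with y hy
  refine lt_of_le_of_lt (supSeminorm_le (r := ε / 2) (by positivity) fun f hf => ?_) (by linarith)
  obtain ⟨g, hg, hfg⟩ := Set.mem_iUnion₂.1 (hKN hf)
  replace hfg : ‖(f : NormDual 𝕜 X) - g‖ < ε / (8 * R) :=
    (dist_eq_norm (f : NormDual 𝕜 X) g).symm.trans_lt hfg
  have hxy : ‖(y : X) - x‖ ≤ 2 * R := (norm_sub_le _ _).trans (by linarith [hR y y.2, hR x x.2])
  have h1 : ‖((f - g : V) : NormDual 𝕜 X) (y - x)‖ ≤ ε / (8 * R) * (2 * R) :=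
    ((f - g : V) : NormDual 𝕜 X).le_of_opNorm_le_of_le hfg.le hxy
  have h2 : ε / (8 * R) * (2 * R) = ε / 4 := by field_simp; norm_num
  have h3 := hy g hg
  rw [← map_sub] at h3
  calc ‖(f : NormDual 𝕜 X) (y - x)‖
      = ‖((f - g : V) : NormDual 𝕜 X) (y - x) + (g : NormDual 𝕜 X) (y - x)‖ := by simp
    _ ≤ ε / 2 := (norm_add_le _ _).trans (by linarith)

end FunctionalSeminorms

/-! ### Traces on bounded sets and mixed topologies -/

section Topologies

theorem CoincideOnBounded.symm {X : Type*} [NormedAddCommGroup X] {t s : TopologicalSpace X}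
    (h : CoincideOnBounded t s) : CoincideOnBounded s t :=
  fun B hB => (h B hB).symm

theorem CoincideOnBounded.trans {X : Type*} [NormedAddCommGroup X] {t s r : TopologicalSpace X}
    (h : CoincideOnBounded t s) (h' : CoincideOnBounded s r) : CoincideOnBounded t r :=
  fun B hB => (h B hB).trans (h' B hB)

theorem CoincideOnBounded.inf {X : Type*} [NormedAddCommGroup X] {t s r : TopologicalSpace X}
    (h : CoincideOnBounded t r) (h' : CoincideOnBounded s r) : CoincideOnBounded (t ⊓ s) r :=
  fun B hB => by rw [induced_inf, h B hB, h' B hB, inf_idem]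

/-- A continuous injection from a compact space into a Hausdorff space is an embedding. -/
theorem induced_subtype_val_eq_of_isCompact {X : Type*} {t s : TopologicalSpace X} (hts : t ≤ s)
    (hs : @T2Space X s) {K : Set X} (hK : @IsCompact X t K) :
    TopologicalSpace.induced ((↑) : K → X) t = TopologicalSpace.induced ((↑) : K → X) s := by
  let : TopologicalSpace K := TopologicalSpace.induced (↑) t
  have : CompactSpace K := (@isCompact_iff_compactSpace X t K).1 hK
  have hcont : @Continuous K X _ s (↑) :=
    continuous_comp_induced (f := id) (continuous_id_iff_le.2 hts) _
  exact (@Continuous.isClosedEmbedding K X _ s _ hs _ hcont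
    Subtype.val_injective).isInducing.eq_induced

theorem coincideOnBounded_of_isCompact {X : Type*} [NormedAddCommGroup X]
    {t s : TopologicalSpace X} (hts : t ≤ s) (hs : @T2Space X s)
    (h : ∀ B : Set X, IsBounded B → ∃ K, B ⊆ K ∧ @IsCompact X t K) : CoincideOnBounded t s := by
  intro B hB
  obtain ⟨K, hBK, hK⟩ := h B hB
  have h := congrArg (TopologicalSpace.induced (Set.inclusion hBK))
    (induced_subtype_val_eq_of_isCompact hts hs hK)
  rwa [induced_compose, induced_compose] at h

theorem IsVectorTopology.inf {𝕜 X : Type*} [RCLike 𝕜] [AddCommGroup X] [Module 𝕜 X]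
    {t s : TopologicalSpace X} (ht : IsVectorTopology 𝕜 t) (hs : IsVectorTopology 𝕜 s) :
    IsVectorTopology 𝕜 (t ⊓ s) :=
  ⟨topologicalAddGroup_inf ht.1 hs.1, @continuousSMul_inf _ _ _ _ _ _ ht.2 hs.2⟩

theorem IsLCHTopology.isVectorTopology {𝕜 X : Type*} [RCLike 𝕜] [AddCommGroup X] [Module 𝕜 X]
    {t : TopologicalSpace X} (ht : IsLCHTopology 𝕜 t) : IsVectorTopology 𝕜 t :=
  ⟨ht.1.withSeminorms'.topologicalAddGroup, ht.1.withSeminorms'.continuousSMul⟩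

theorem le_of_nhds_zero_le {X : Type*} [AddGroup X] {t s : TopologicalSpace X}
    (ht : @IsTopologicalAddGroup X t _) (hs : @IsTopologicalAddGroup X s _)
    (h : @nhds X t 0 ≤ @nhds X s 0) : t ≤ s := by
  rw [← continuous_id_iff_le]
  exact @continuous_of_continuousAt_zero X t _ ht X _ _ s _ _ _ (AddMonoidHom.id X) h

variable {𝕜 X : Type*} [RCLike 𝕜] [NormedAddCommGroup X] [NormedSpace 𝕜 X]

/-- The infimum of `γ(‖·‖, τ)` and `σ` competes in the definition of `γ(‖·‖, σ)`; the infimum is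
needed because `γ(‖·‖, τ)` need not be visibly finer than `σ`. -/
theorem mixedTopology_le_mixedTopology {τ σ : TopologicalSpace X} (hτ : IsPreSaks 𝕜 τ)
    (hσ : IsPreSaks 𝕜 σ) (h : CoincideOnBounded τ σ) :
    mixedTopology 𝕜 σ ≤ mixedTopology 𝕜 τ := by
  obtain ⟨⟨hv, hc, hle, hn⟩, -⟩ := isLeast_mixedTopology hτ
  refine (sInf_le ?_ : mixedTopology 𝕜 σ ≤ mixedTopology 𝕜 τ ⊓ σ).trans inf_le_left
  exact ⟨hv.inf hσ.1.isVectorTopology, (hc.trans h).inf fun _ _ => rfl, inf_le_right,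
    le_inf hn hσ.2⟩

/-- The mixed topology depends only on the traces of the coarser topology on bounded sets. -/
theorem mixedTopology_congr {τ σ : TopologicalSpace X} (hτ : IsPreSaks 𝕜 τ)
    (hσ : IsPreSaks 𝕜 σ) (h : CoincideOnBounded τ σ) : mixedTopology 𝕜 τ = mixedTopology 𝕜 σ :=
  le_antisymm (mixedTopology_le_mixedTopology hσ hτ h.symm)
    (mixedTopology_le_mixedTopology hτ hσ h)

/-- A group topology that coincides on bounded sets with a topology coarser than the norm topology
is coarser than the norm topology. -/
theorem normTopology_le_of_coincideOnBounded {t s : TopologicalSpace X}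
    (ht : @IsTopologicalAddGroup X t _) (hs : normTopology X ≤ s) (h : CoincideOnBounded t s) :
    normTopology X ≤ t := by
  refine le_of_nhds_zero_le inferInstance ht ?_
  -- The unit ball is a norm neighbourhood of `0`, so comparing traces on it suffices.
  have h0 : (0 : X) ∈ Metric.closedBall (0 : X) 1 := by simp
  have hB := h (Metric.closedBall 0 1) Metric.isBounded_closedBall
  have hle : TopologicalSpace.induced ((↑) : Metric.closedBall (0 : X) 1 → X) (normTopology X) ≤
      TopologicalSpace.induced (↑) t := hB ▸ induced_mono hs
  have := le_iff_nhds _ _ |>.1 hle ⟨0, h0⟩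
  rw [@nhds_induced _ _ (normTopology X), @nhds_induced _ _ t, ← Filter.map_le_iff_le_comap, Filter.map_comap,
    Subtype.range_coe, inf_eq_left.2] at this
  · exact this
  · exact Filter.le_principal_iff.2 (Metric.closedBall_mem_nhds 0 one_pos)

end Topologies

/-! ### The Banach–Dieudonné theorem -/

section BanachDieudonne

variable {𝕜 X : Type*} [RCLike 𝕜] [NormedAddCommGroup X] [NormedSpace 𝕜 X]
  {V : Submodule 𝕜 (NormDual 𝕜 X)}

/-- The hypothesis says that the elements of `s` tend to `0` along the cofinite filter. -/
theorem isCompact_insert_zero_of_finite {s : Set V}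
    (h : ∀ ε > 0, {f ∈ s | ε ≤ ‖(f : NormDual 𝕜 X)‖}.Finite) : IsCompact (insert 0 s) := by
  have ht : Filter.Tendsto (fun f : s => (f.1 : NormDual 𝕜 X)) Filter.cofinite
      (𝓝 (0 : NormDual 𝕜 X)) := by
    refine tendsto_zero_iff_norm_tendsto_zero.2 (Metric.tendsto_nhds.2 fun ε hε =>
      Filter.eventually_cofinite.2 ?_)
    refine Set.Finite.of_finite_image ((h ε hε).subset ?_) Subtype.val_injective.injOn
    rintro _ ⟨g, hg, rfl⟩
    exact ⟨g.2, by simpa using hg⟩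
  have ht' : Filter.Tendsto (Subtype.val : s → V) Filter.cofinite (𝓝 0) := tendsto_subtype_rng.2 ht
  have := ht'.isCompact_insert_range_of_cofinite
  rwa [Subtype.range_coe] at this

/-- The points of norm at most `n` in the polar of the finite set `G` lie in `U`. -/
def PolarSubset (U : Set X) (n : ℕ) (G : Finset V) : Prop :=
  ∀ x : X, ‖x‖ ≤ n → (∀ f ∈ G, ‖(f : NormDual 𝕜 X) x‖ ≤ 1) → x ∈ U

theorem IsCompact.exists_finset_of_forall {A ι : Type*} [TopologicalSpace A] {C : Set A}
    (hC : IsCompact C) {g : ι → A → ℝ} (hg : ∀ i, Continuous (g i))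
    (h : ∀ x ∈ C, ∃ i, 1 < g i x) : ∃ u : Finset ι, ∀ x ∈ C, ∃ i ∈ u, 1 < g i x := by
  obtain ⟨u, hu⟩ := hC.elim_finite_subfamily_closed (fun i => {x | g i x ≤ 1})
    (fun i => isClosed_le (hg i) continuous_const) (by
      ext x
      simpa using h x)
  refine ⟨u, fun x hx => ?_⟩
  by_contra! hcon
  exact (hu ▸ ⟨hx, Set.mem_iInter₂.2 hcon⟩ : x ∈ (∅ : Set A))

theorem isCompact_diff_of_induced_eq {A : Type*} {t s : TopologicalSpace A} {B U : Set A}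
    (h : TopologicalSpace.induced ((↑) : B → A) t = TopologicalSpace.induced ((↑) : B → A) s)
    (hB : @IsCompact A s B) (hU : IsOpen[t] U) : @IsCompact A s (B \ U) := by
  have hU' : IsOpen[TopologicalSpace.induced ((↑) : B → A) s] ((↑) ⁻¹' U : Set B) :=
    h ▸ ⟨U, hU, rfl⟩
  obtain ⟨W, hW, hWU⟩ := hU'
  have : B \ U = B \ W := by
    ext x
    refine and_congr_right fun hx => not_congr ?_
    exact (Set.ext_iff.1 hWU ⟨x, hx⟩).symm
  rw [this]
  exact hB.diff hW

/-- A point outside `U` in the polar of `G` and of all functionals of norm at most `1 / n` would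
have norm at most `n` since `V` is norming, contradicting `hG`. As the ball of radius `n + 1` minus
`U` is compact, finitely many of these functionals suffice. -/
theorem PolarSubset.exists_superset {U : Set X} {t : TopologicalSpace X}
    (hball : ∀ R, @IsCompact X (weakTopologyOf V) (Metric.closedBall 0 R))
    (hnorm : ∀ (x : X) (r : ℝ), 0 ≤ r →
      (∀ f ∈ V, r * ‖f‖ ≤ 1 → ‖f x‖ ≤ 1) → ‖x‖ ≤ r)
    (ht : CoincideOnBounded t (weakTopologyOf V)) (hU : IsOpen[t] U) (n : ℕ) (G : Finset V)
    (hG : PolarSubset U n G) : ∃ H : Finset V, PolarSubset U (n + 1) H ∧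
      G ⊆ H ∧ ∀ f ∈ H, f ∈ G ∨ n * ‖(f : NormDual 𝕜 X)‖ ≤ 1 := by
  classical
  have hC := isCompact_diff_of_induced_eq (ht _ Metric.isBounded_closedBall)
    (hball (n + 1 : ℕ)) hU
  obtain ⟨u, hu⟩ := @IsCompact.exists_finset_of_forall X
    {f : V // f ∈ G ∨ n * ‖(f : NormDual 𝕜 X)‖ ≤ 1} (weakTopologyOf V) _ hC
    (fun f x => ‖(f.1 : NormDual 𝕜 X) x‖)
    (fun f => @Continuous.comp X 𝕜 ℝ (weakTopologyOf V) _ _ _ _ continuous_norm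
      (continuous_apply_weakTopologyOf f.1)) (by
      rintro x ⟨-, hxU⟩
      by_contra! hcon
      refine hxU (hG x (hnorm x n n.cast_nonneg fun f hf hfn => ?_) fun f hf => ?_)
      · exact hcon ⟨⟨f, hf⟩, Or.inr hfn⟩
      · exact hcon ⟨f, Or.inl hf⟩)
  refine ⟨G ∪ u.image Subtype.val, fun x hx hxH => ?_, Finset.subset_union_left, fun f hf => ?_⟩
  · by_contra hxU
    obtain ⟨f, hf, h1⟩ := hu x ⟨mem_closedBall_zero_iff.2 hx, hxU⟩
    exact h1.not_ge (hxH f.1 (Finset.mem_union_right _ (Finset.mem_image_of_mem _ hf)))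
  · refine (Finset.mem_union.1 hf).elim Or.inl fun hf => ?_
    obtain ⟨g, -, rfl⟩ := Finset.mem_image.1 hf
    exact g.2

theorem exists_seq_of_step {A : Type*} {P : ℕ → A → Prop} {R : ℕ → A → A → Prop} {a : A}
    (ha : P 0 a) (h : ∀ n a, P n a → ∃ b, P (n + 1) b ∧ R n a b) :
    ∃ S : ℕ → A, S 0 = a ∧ (∀ n, P n (S n)) ∧ ∀ n, R n (S n) (S (n + 1)) := by
  choose F hP hR using h
  let S : ∀ n, {b // P n b} := fun n => Nat.rec ⟨a, ha⟩ (fun n b => ⟨F n b.1 b.2, hP n b.1 b.2⟩) n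
  exact ⟨fun n => (S n).1, rfl, fun n => (S n).2, fun n => hR n _ _⟩

/-- The functionals added at stage `n` have norm at most `1 / n`, so all stages together with `0`
form a compact set. Convexity of `U` plays no role. -/
theorem exists_isCompact_polar_subset {U : Set X} {t : TopologicalSpace X}
    (hball : ∀ R, @IsCompact X (weakTopologyOf V) (Metric.closedBall 0 R))
    (hnorm : ∀ (x : X) (r : ℝ), 0 ≤ r →
      (∀ f ∈ V, r * ‖f‖ ≤ 1 → ‖f x‖ ≤ 1) → ‖x‖ ≤ r)
    (ht : CoincideOnBounded t (weakTopologyOf V)) (hU : IsOpen[t] U) (h0 : (0 : X) ∈ U) :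
    ∃ K : Set V, IsCompact K ∧
      ∀ x : X, (∀ f ∈ K, ‖(f : NormDual 𝕜 X) x‖ ≤ 1) → x ∈ U := by
  -- The empty set works at stage `0`, because the ball of radius `0` is `{0}`.
  obtain ⟨S, hS0, hS, hstep⟩ := exists_seq_of_step (P := PolarSubset (V := V) U) (a := ∅)
    (fun x hx _ => by
      rw [Nat.cast_zero, norm_le_zero_iff] at hx
      exact hx ▸ h0) (PolarSubset.exists_superset hball hnorm ht hU)
  have hmono : Monotone S := monotone_nat_of_le_succ fun n => (hstep n).1
  -- A functional not yet present at stage `M` is added later, hence has norm at most `1 / M`.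
  have hsmall (M n : ℕ) (f : V) (hf : f ∈ S n) :
      f ∈ S M ∨ M * ‖(f : NormDual 𝕜 X)‖ ≤ 1 := by
    induction n with
    | zero => exact absurd (hS0 ▸ hf) (Finset.notMem_empty f)
    | succ n ih =>
      rcases le_or_gt M n with hMn | hMn
      · refine ((hstep n).2 f hf).elim ih fun hf => Or.inr ?_
        exact le_trans (by gcongr) hf
      · exact Or.inl (hmono hMn hf)
  have hfin (ε : ℝ) (hε : 0 < ε) :
      {f ∈ ⋃ n, (S n : Set V) | ε ≤ ‖(f : NormDual 𝕜 X)‖}.Finite := by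
    obtain ⟨M, hM⟩ := exists_nat_gt (1 / ε)
    refine (S M).finite_toSet.subset ?_
    rintro f ⟨hf, hfε⟩
    obtain ⟨n, hn⟩ := Set.mem_iUnion.1 hf
    refine (hsmall M n f hn).resolve_right fun hle => ?_
    rw [div_lt_iff₀ hε] at hM
    have : (M : ℝ) * ε ≤ M * ‖(f : NormDual 𝕜 X)‖ := by gcongr
    linarith
  have hK : IsCompact (insert 0 (⋃ n, (S n : Set V))) := isCompact_insert_zero_of_finite hfin
  refine ⟨_, hK, fun x hx => ?_⟩
  obtain ⟨n, hn⟩ := exists_nat_ge ‖x‖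
  exact hS n x hn fun f hf => hx f (Or.inr (Set.mem_iUnion.2 ⟨n, hf⟩))

theorem topologicalAddGroup_moduleFilterBasis {𝕜 E ι : Type*} [RCLike 𝕜] [AddCommGroup E]
    [Module 𝕜 E] (p : SeminormFamily 𝕜 E ι) :
    @IsTopologicalAddGroup E p.moduleFilterBasis.topology _ :=
  let := p.moduleFilterBasis.topology
  WithSeminorms.topologicalAddGroup (p := p) ⟨rfl⟩

theorem mem_nhds_zero_of_seminorm_le {𝕜 E ι : Type*} [RCLike 𝕜] [AddCommGroup E] [Module 𝕜 E]
    (p : SeminormFamily 𝕜 E ι) (i : ι) {U : Set E} (h : ∀ x, p i x ≤ 1 → x ∈ U) :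
    U ∈ @nhds E p.moduleFilterBasis.topology 0 := by
  let := p.moduleFilterBasis.topology
  have hp : WithSeminorms p := ⟨rfl⟩
  refine (hp.mem_nhds_iff 0 U).2 ⟨{i}, 1, one_pos, fun x hx => h x ?_⟩
  rw [Finset.sup_singleton, Seminorm.mem_ball_zero] at hx
  exact hx.le

/-- The **Banach–Dieudonné theorem** for a norming space `V` of functionals for which the closed
balls are `σ(X, V)`-compact: the topology of uniform convergence on compact subsets of `V` is finer
than every group topology that coincides with `σ(X, V)` on bounded sets. -/
theorem compactTopologyOf_le_of_coincideOnBounded {t : TopologicalSpace X}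
    (hball : ∀ R, @IsCompact X (weakTopologyOf V) (Metric.closedBall 0 R))
    (hnorm : ∀ (x : X) (r : ℝ), 0 ≤ r →
      (∀ f ∈ V, r * ‖f‖ ≤ 1 → ‖f x‖ ≤ 1) → ‖x‖ ≤ r)
    (htg : @IsTopologicalAddGroup X t _)
    (ht : CoincideOnBounded t (weakTopologyOf V)) : compactTopologyOf V ≤ t := by
  refine le_of_nhds_zero_le (topologicalAddGroup_moduleFilterBasis (compactSeminorms V)) htg
    fun U hU => ?_
  obtain ⟨W, hWU, hW, h0⟩ := (@mem_nhds_iff X t 0 U).1 hU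
  obtain ⟨K, hK, hKW⟩ := exists_isCompact_polar_subset hball hnorm ht hW h0
  refine mem_nhds_zero_of_seminorm_le (compactSeminorms V) ⟨K, hK⟩ fun x hx => hWU (hKW x ?_)
  exact fun f hf => (norm_apply_le_supSeminorm _ hf x).trans hx

end BanachDieudonne

/-! ### Hahn–Banach, semi-reflexive and Montel spaces -/

section TopologicalVectorSpaces

theorem isCompact_induced_of_isCompact_image {A Y : Type*} [TopologicalSpace Y] {e : A → Y}
    {s : Set A} (h : IsCompact (e '' s)) : @IsCompact A (TopologicalSpace.induced e inferInstance) s := by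
  let := TopologicalSpace.induced e inferInstance
  exact (IsInducing.mk rfl : IsInducing e).isCompact_iff.2 h

variable {𝕜 E : Type*} [RCLike 𝕜] [AddCommGroup E] [Module 𝕜 E]

/-- Hahn–Banach extension of `a • x ↦ a * q x` from the line through `x`. -/
theorem Seminorm.exists_dual_apply_eq (q : Seminorm 𝕜 E) {x : E} (hx : x ≠ 0) :
    ∃ g : Module.Dual 𝕜 E, g x = (q x : 𝕜) ∧ ∀ y, ‖g y‖ ≤ q y := by
  let c := LinearEquiv.toSpanNonzeroSingleton 𝕜 E x hx
  obtain ⟨g, hg, hgq⟩ := Module.Dual.exists_extension_of_le_seminorm (𝕜 ∙ x)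
    ((q x : 𝕜) • (c.symm : (𝕜 ∙ x) →ₗ[𝕜] 𝕜)) (p := q) (fun y => by
      obtain ⟨a, rfl⟩ := c.surjective y
      rw [LinearMap.smul_apply, LinearEquiv.coe_coe, c.symm_apply_apply, norm_smul,
        LinearEquiv.toSpanNonzeroSingleton_apply, map_smul_eq_mul, RCLike.norm_ofReal,
        abs_of_nonneg (apply_nonneg q x), mul_comm])
  refine ⟨g, ?_, hgq⟩
  have h := hg (c 1)
  rw [LinearMap.smul_apply, LinearEquiv.coe_coe, c.symm_apply_apply, smul_eq_mul, mul_one,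
    LinearEquiv.toSpanNonzeroSingleton_apply] at h
  exact (congrArg g (one_smul 𝕜 x)).symm.trans h

theorem continuous_of_norm_le_seminorm [TopologicalSpace E] {ι : Type*} {p : SeminormFamily 𝕜 E ι}
    (hp : WithSeminorms p) {g : Module.Dual 𝕜 E} {i : ι} (h : ∀ y, ‖g y‖ ≤ p i y) :
    Continuous g :=
  hp.continuous_normedSpace_rng 𝕜 g ⟨{i}, 1, fun x => by simpa using h x⟩

/-- In a semi-reflexive space, a linear functional on the dual that is bounded on the polar of a
bounded set is the evaluation at a point. -/
theorem IsSemireflexive.exists_eq_apply [TopologicalSpace E] [IsTopologicalAddGroup E]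
    [ContinuousSMul 𝕜 E] (hE : IsSemireflexive 𝕜 E) {B : Set E} (hB : IsVonNBounded 𝕜 B) {C : ℝ}
    (ψ : ∀ f : Module.Dual 𝕜 E, Continuous f → 𝕜)
    (hadd : ∀ f g hf hg hfg, ψ (f + g) hfg = ψ f hf + ψ g hg)
    (hsmul : ∀ (c : 𝕜) f hf hcf, ψ (c • f) hcf = c • ψ f hf)
    (hC : ∀ f hf, (∀ x ∈ B, ‖f x‖ ≤ 1) → ‖ψ f hf‖ ≤ C) :
    ∃ x, ∀ f hf, ψ f hf = f x := by
  let Φ : StrongDual 𝕜 E →ₗ[𝕜] 𝕜 :=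
    { toFun f := ψ f f.continuous
      map_add' f g := hadd f g _ _ (f + g).continuous
      map_smul' c f := hsmul c f _ (c • f).continuous }
  -- The polar of `B` is a strong neighbourhood of `0` on which `Φ` is bounded by `C`; hence `Φ` is
  -- continuous.
  have hΦ : ∃ U ∈ 𝓝 (0 : StrongDual 𝕜 E), IsVonNBounded 𝕜 (Φ '' U) := by
    refine ⟨_, ContinuousLinearMap.eventually_nhds_zero_mapsTo hB
      (Metric.closedBall_mem_nhds (0 : 𝕜) one_pos), ?_⟩
    refine (NormedSpace.isVonNBounded_iff 𝕜).2 (isBounded_iff_forall_norm_le.2 ⟨C, ?_⟩)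
    rintro _ ⟨f, hf, rfl⟩
    exact hC f f.continuous fun x hx => mem_closedBall_zero_iff.1 (hf hx)
  obtain ⟨x, hx⟩ := hE (Φ.clmOfExistsBoundedImage hΦ)
  exact ⟨x, fun f hf => hx ⟨f, hf⟩⟩

theorem MontelSpace.exists_isCompact_superset [TopologicalSpace E] [IsTopologicalAddGroup E]
    [ContinuousSMul 𝕜 E] [T2Space E] [MontelSpace 𝕜 E] {B : Set E} (hB : IsVonNBounded 𝕜 B) :
    ∃ K, B ⊆ K ∧ IsCompact K :=
  ⟨closure B, subset_closure,
    MontelSpace.isCompact_of_isClosed_of_isVonNBounded 𝕜 isClosed_closure hB.closure⟩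

end TopologicalVectorSpaces

/-! ### Pre-Saks spaces and comparison of topologies -/

section Topologies

variable {𝕜 X : Type*} [RCLike 𝕜] [NormedAddCommGroup X] [NormedSpace 𝕜 X]

theorem continuous_normDual (f : NormDual 𝕜 X) : Continuous f := f.continuous

/-- A norm-continuous linear functional as an element of the norm dual. -/
def normDualMk (f : Module.Dual 𝕜 X) (hf : Continuous f) : NormDual 𝕜 X := ⟨f, hf⟩

theorem norm_normDualMk_le (f : Module.Dual 𝕜 X) (hf : Continuous f)
    (h : ∀ x ∈ Metric.closedBall (0 : X) 1, ‖f x‖ ≤ 1) : ‖normDualMk f hf‖ ≤ 1 :=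
  ContinuousLinearMap.opNorm_le_of_unit_norm zero_le_one fun y hy =>
    h y (mem_closedBall_zero_iff.2 hy.le)

variable {Ω : Type*} {ev : X →ₗ[𝕜] (Ω → 𝕜)}

theorem le_pointwiseTopology {t : TopologicalSpace X}
    (h : ∀ x, Continuous[t, inferInstance] fun f => ev f x) : t ≤ pointwiseTopology ev :=
  continuous_iff_le_induced.1 (@continuous_pi X Ω (fun _ => 𝕜) t _ _ h)

theorem polynormableSpace_pointwiseTopology (ev : X →ₗ[𝕜] (Ω → 𝕜)) :
    PolynormableSpace 𝕜 X (topology := pointwiseTopology ev) := by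
  have : PolynormableSpace 𝕜 (Ω → 𝕜) :=
    (withSeminorms_pi fun _ : Ω => norm_withSeminorms 𝕜 𝕜).toPolynormableSpace
  exact PolynormableSpace.induced ev

theorem t2Space_pointwiseTopology (hev : Function.Injective ev) :
    @T2Space X (pointwiseTopology ev) :=
  @T2Space.of_injective_continuous X _ (pointwiseTopology ev) _ _ _ hev continuous_induced_dom

theorem isPreSaks_pointwiseTopology (hev : Function.Injective ev)
    (h : ∀ x, Continuous fun f => ev f x) : IsPreSaks 𝕜 (pointwiseTopology ev) :=
  ⟨⟨polynormableSpace_pointwiseTopology ev, t2Space_pointwiseTopology hev⟩, le_pointwiseTopology h⟩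

theorem isPreSaks_weakTopologyOf {V : Submodule 𝕜 (NormDual 𝕜 X)}
    (hV : @T2Space X (weakTopologyOf V)) : IsPreSaks 𝕜 (weakTopologyOf V) :=
  ⟨⟨polynormableSpace_of_eq (finiteSeminorms V) rfl, hV⟩, normTopology_le_weakTopologyOf V⟩

theorem boundedWeakStarTopology_le_compactTopologyOf {V : Submodule 𝕜 (NormDual 𝕜 X)}
    (hV : @T2Space X (weakTopologyOf V)) : boundedWeakStarTopology V ≤ compactTopologyOf V :=
  sInf_le ⟨⟨polynormableSpace_of_eq (compactSeminorms V) rfl,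
    t2Space_antitone (compactTopologyOf_le_weakTopologyOf V) hV⟩,
    coincideOnBounded_compactTopologyOf V⟩

/-- For each `t` competing for the bounded weak* topology, `t ⊓ σ(X, V)` competes for the mixed
topology. -/
theorem mixedTopology_le_boundedWeakStarTopology {V : Submodule 𝕜 (NormDual 𝕜 X)}
    (hV : @T2Space X (weakTopologyOf V)) :
    mixedTopology 𝕜 (weakTopologyOf V) ≤ boundedWeakStarTopology V := by
  have hσ := isPreSaks_weakTopologyOf hV
  refine le_sInf fun t ⟨ht, hc⟩ => (sInf_le ?_ :
    mixedTopology 𝕜 (weakTopologyOf V) ≤ t ⊓ weakTopologyOf V).trans inf_le_left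
  exact ⟨ht.isVectorTopology.inf hσ.1.isVectorTopology, hc.inf fun _ _ => rfl, inf_le_right,
    le_inf (normTopology_le_of_coincideOnBounded ht.isVectorTopology.1 hσ.2 hc) hσ.2⟩

end Topologies

/-! ### Compactness in Saks spaces -/

section SaksSpaces

variable {𝕜 X : Type*} [RCLike 𝕜] [NormedAddCommGroup X] [NormedSpace 𝕜 X]
  {τ : TopologicalSpace X}

theorem IsSaks.mixedTopology_le (hτ : IsSaks 𝕜 τ) : mixedTopology 𝕜 τ ≤ τ :=
  (isLeast_mixedTopology hτ.1).1.2.2.1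

theorem IsSaks.isVonNBounded_mixedTopology (hτ : IsSaks 𝕜 τ) {B : Set X} (hB : IsBounded B) :
    @IsVonNBounded 𝕜 X _ _ _ (mixedTopology 𝕜 τ) B :=
  IsVonNBounded.of_topologicalSpace_le (isLeast_mixedTopology hτ.1).1.2.2.2
    ((NormedSpace.isVonNBounded_iff 𝕜).2 hB)

/-- The mixed dual of a Saks space is norming. -/
theorem IsSaks.norm_le_of_forall_mixedDual (hτ : IsSaks 𝕜 τ) (x : X) (r : ℝ) (hr : 0 ≤ r)
    (h : ∀ f ∈ mixedDual 𝕜 τ, r * ‖f‖ ≤ 1 → ‖f x‖ ≤ 1) : ‖x‖ ≤ r := by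
  obtain ⟨-, Γ, -, hΓ, hlub⟩ := id hτ
  refine (hlub x).2 ?_
  rintro _ ⟨q, hq, rfl⟩
  by_contra! hlt
  have hqx : 0 < q x := hr.trans_lt hlt
  have hx : x ≠ 0 := by
    rintro rfl
    simp at hqx
  obtain ⟨g, hgx, hgq⟩ := q.exists_dual_apply_eq hx
  have hg1 (y : X) : ‖g y‖ ≤ 1 * ‖y‖ := by
    rw [one_mul]
    exact (hgq y).trans ((hlub y).1 ⟨q, hq, rfl⟩)
  have hgc : Continuous[τ, _] g :=
    @continuous_of_norm_le_seminorm 𝕜 X _ _ _ τ _ _ hΓ g ⟨q, hq⟩ hgq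
  let f : NormDual 𝕜 X := g.mkContinuous 1 hg1
  have hf : f ∈ mixedDual 𝕜 τ := continuous_le_dom hτ.mixedTopology_le hgc
  have hf1 : ‖f‖ ≤ 1 := g.mkContinuous_norm_le zero_le_one hg1
  -- Scaling by `s⁻¹` with `r < s < q x` makes the value at `x` exceed `1` and also covers `r = 0`.
  obtain ⟨s, hrs, hsq⟩ := exists_between hlt
  have hs : 0 < s := hr.trans_lt hrs
  have hns : ‖((s⁻¹ : ℝ) : 𝕜)‖ = s⁻¹ := by
    rw [RCLike.norm_ofReal, abs_of_pos (inv_pos.2 hs)]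
  have h1 := h (((s⁻¹ : ℝ) : 𝕜) • f) (Submodule.smul_mem _ _ hf) (by
    rw [norm_smul, hns]
    calc r * (s⁻¹ * ‖f‖) ≤ s * (s⁻¹ * 1) := by gcongr
      _ = 1 := by field_simp)
  have hfx : ‖f x‖ = q x := by
    change ‖g x‖ = q x
    rw [hgx, RCLike.norm_ofReal, abs_of_pos hqx]
  rw [smul_apply, norm_smul, hns, hfx, inv_mul_le_iff₀ hs, mul_one] at h1
  linarith

/-- The unit ball is `γ`-bounded and its polar lies in the dual unit ball, so `ψ` is bounded on a
polar. -/
theorem IsSemireflexiveSaks.exists_eq_apply (hτ : IsSemireflexiveSaks 𝕜 τ) {R : ℝ}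
    (ψ : mixedDual 𝕜 τ → 𝕜) (hadd : ∀ f g, ψ (f + g) = ψ f + ψ g)
    (hsmul : ∀ (c : 𝕜) f, ψ (c • f) = c • ψ f)
    (hR : ∀ f, ‖ψ f‖ ≤ R * ‖(f : NormDual 𝕜 X)‖) :
    ∃ x : X, ∀ f : mixedDual 𝕜 τ, ψ f = (f : NormDual 𝕜 X) x := by
  obtain ⟨⟨hg, hs⟩, -, -, hn⟩ := (isLeast_mixedTopology hτ.1.1).1
  have hc (f : Module.Dual 𝕜 X) (hf : Continuous[mixedTopology 𝕜 τ, inferInstance] f) :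
      Continuous[normTopology X, inferInstance] f := continuous_le_dom hn hf
  obtain ⟨x, hx⟩ := @IsSemireflexive.exists_eq_apply 𝕜 X _ _ _ (mixedTopology 𝕜 τ) hg hs hτ.2
    (Metric.closedBall 0 1) (hτ.1.isVonNBounded_mixedTopology Metric.isBounded_closedBall) |R|
    (fun f hf => ψ ⟨normDualMk f (hc f hf), hf⟩)
    (fun f g hf hg _ => hadd ⟨normDualMk f (hc f hf), hf⟩ ⟨normDualMk g (hc g hg), hg⟩)
    (fun c f hf _ => hsmul c ⟨normDualMk f (hc f hf), hf⟩) (fun f hf hf1 => by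
      refine (hR _).trans ((mul_le_mul_of_nonneg_right (le_abs_self R) (norm_nonneg _)).trans ?_)
      exact mul_le_of_le_one_right (abs_nonneg R) (norm_normDualMk_le f _ hf1))
  exact ⟨x, fun f => hx f.1 f.2⟩

theorem IsSemireflexiveSaks.isCompact_closedBall (hτ : IsSemireflexiveSaks 𝕜 τ) (R : ℝ) :
    @IsCompact X (weakTopologyOf (mixedDual 𝕜 τ)) (Metric.closedBall 0 R) := by
  rw [weakTopologyOf_eq_induced]
  refine isCompact_induced_of_isCompact_image ?_
  rcases lt_or_ge R 0 with hR | hR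
  · simp [Metric.closedBall_eq_empty.2 hR]
  have himage : (fun x (f : mixedDual 𝕜 τ) => (f : NormDual 𝕜 X) x) '' Metric.closedBall 0 R =
      {ψ | ∀ f g, ψ (f + g) = ψ f + ψ g} ∩ {ψ | ∀ (c : 𝕜) f, ψ (c • f) = c • ψ f} ∩
        Set.univ.pi fun f : mixedDual 𝕜 τ =>
          Metric.closedBall (0 : 𝕜) (R * ‖(f : NormDual 𝕜 X)‖) := by
    ext ψ
    constructor
    · rintro ⟨x, hx, rfl⟩
      refine ⟨⟨fun f g => rfl, fun c f => rfl⟩, fun f _ => ?_⟩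
      rw [mem_closedBall_zero_iff] at hx ⊢
      rw [mul_comm]
      exact (f : NormDual 𝕜 X).le_opNorm_of_le hx
    · rintro ⟨⟨hadd, hsmul⟩, hψ⟩
      have hψ' (f) : ‖ψ f‖ ≤ R * ‖(f : NormDual 𝕜 X)‖ :=
        mem_closedBall_zero_iff.1 (hψ f (Set.mem_univ f))
      obtain ⟨x, hx⟩ := hτ.exists_eq_apply ψ hadd hsmul hψ'
      refine ⟨x, mem_closedBall_zero_iff.2 ?_, (funext hx).symm⟩
      exact hτ.1.norm_le_of_forall_mixedDual x R hR fun f hf h1 =>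
        (hx ⟨f, hf⟩).symm ▸ (hψ' ⟨f, hf⟩).trans h1
  rw [himage]
  refine (isCompact_univ_pi fun f => ProperSpace.isCompact_closedBall _ _).inter_left (IsClosed.inter ?_ ?_)
  · simp only [Set.ofPred_forall]
    exact isClosed_iInter fun f => isClosed_iInter fun g => isClosed_eq (by fun_prop) (by fun_prop)
  · simp only [Set.ofPred_forall]
    exact isClosed_iInter fun c => isClosed_iInter fun f => isClosed_eq (by fun_prop) (by fun_prop)

/-- Bounded sets lie in `γ`-compact sets, on which `γ` agrees with `s`; `γ` agrees with `τ` on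
bounded sets by definition. -/
theorem IsSemiMontelSaks.mixedTopology_eq (hτ : IsSemiMontelSaks 𝕜 τ) {s : TopologicalSpace X}
    (hs : IsPreSaks 𝕜 s) (hle : mixedTopology 𝕜 τ ≤ s) :
    mixedTopology 𝕜 τ = mixedTopology 𝕜 s := by
  obtain ⟨⟨hg, hm⟩, hc, hle', -⟩ := (isLeast_mixedTopology hτ.1.1).1
  refine mixedTopology_congr hτ.1.1 hs (hc.symm.trans ?_)
  refine coincideOnBounded_of_isCompact hle hs.1.2 fun B hB => ?_
  exact @MontelSpace.exists_isCompact_superset 𝕜 X _ _ _ (mixedTopology 𝕜 τ) hg hm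
    (t2Space_antitone hle' hτ.1.1.1.2) hτ.2 B (hτ.1.isVonNBounded_mixedTopology hB)

end SaksSpaces

/-- A normed space of `𝕜`-valued functions on `Ω` is a normed space `F` with an injective linear map
`ev` into `Ω → 𝕜`. -/
theorem proposition4 {𝕜 : Type*} [RCLike 𝕜] {Ω : Type*} [Nonempty Ω]
    {F : Type*} [NormedAddCommGroup F] [NormedSpace 𝕜 F]
    (ev : F →ₗ[𝕜] (Ω → 𝕜)) (hev : Function.Injective ev)
    (τ : TopologicalSpace F) (hτ : IsSemireflexiveSaks 𝕜 τ)
    (hδ : ∀ x : Ω, ∃ δ ∈ mixedDual 𝕜 τ, ∀ f : F, δ f = ev f x) :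
    (IsPreSaks 𝕜 (pointwiseTopology ev) ∧ IsPreSaks 𝕜 (weakTopologyOf (mixedDual 𝕜 τ))) ∧
    mixedTopology 𝕜 (pointwiseTopology ev) =
      mixedTopology 𝕜 (weakTopologyOf (mixedDual 𝕜 τ)) ∧
    mixedTopology 𝕜 (weakTopologyOf (mixedDual 𝕜 τ)) =
      boundedWeakStarTopology (mixedDual 𝕜 τ) ∧
    boundedWeakStarTopology (mixedDual 𝕜 τ) = compactTopologyOf (mixedDual 𝕜 τ) ∧
    (IsSemiMontelSaks 𝕜 τ → mixedTopology 𝕜 τ = mixedTopology 𝕜 (pointwiseTopology ev)) := by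
  choose δ hδV hδev using hδ
  have hγp : mixedTopology 𝕜 τ ≤ pointwiseTopology ev := le_pointwiseTopology fun x =>
    (funext (hδev x) : ⇑(δ x) = fun f => ev f x) ▸ hδV x
  have hσp : weakTopologyOf (mixedDual 𝕜 τ) ≤ pointwiseTopology ev := le_pointwiseTopology fun x =>
    (funext (hδev x) : ⇑(δ x) = fun f => ev f x) ▸ continuous_apply_weakTopologyOf ⟨δ x, hδV x⟩
  have hp : IsPreSaks 𝕜 (pointwiseTopology ev) := isPreSaks_pointwiseTopology hev fun x =>
    (funext (hδev x) : ⇑(δ x) = fun f => ev f x) ▸ continuous_normDual (δ x)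
  have hT2 : @T2Space F (weakTopologyOf (mixedDual 𝕜 τ)) := t2Space_antitone hσp hp.1.2
  have hσ := isPreSaks_weakTopologyOf hT2
  have hσc : CoincideOnBounded (weakTopologyOf (mixedDual 𝕜 τ)) (pointwiseTopology ev) :=
    coincideOnBounded_of_isCompact hσp hp.1.2 fun B hB => by
      obtain ⟨R, hR⟩ := hB.subset_closedBall 0
      exact ⟨_, hR, hτ.isCompact_closedBall R⟩
  obtain ⟨⟨hg, -⟩, hc, -, -⟩ := (isLeast_mixedTopology hσ).1
  -- Banach–Dieudonné applies to the mixed topology, which is only known to be linear at this point.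
  have hcγ := compactTopologyOf_le_of_coincideOnBounded hτ.isCompact_closedBall
    hτ.1.norm_le_of_forall_mixedDual hg hc
  have hbc := boundedWeakStarTopology_le_compactTopologyOf hT2
  have hγb := mixedTopology_le_boundedWeakStarTopology hT2
  exact ⟨⟨hp, hσ⟩, mixedTopology_congr hp hσ hσc.symm, le_antisymm hγb (hbc.trans hcγ),
    le_antisymm hbc (hcγ.trans hγb), fun hM => hM.mixedTopology_eq hp hγp⟩
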